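/- Let $D$ be a skew field, $R\supseteq D$ a ring and $x_1,\dots,x_n\in R$ such that the standard monomials $x^\alpha=x_1^{\alpha_1}\cdots x_n^{\alpha_n}$ ($\alpha\in\mathbb N^n$) form a basis of $R$ as a left $D$-vector space. Let $\preceq$ be an admissible order on $\mathbb N^n$ (a total order with $0\preceq\alpha$ for all $\alpha$, compatible with addition). For $0\ne f=\sum_\alpha c_\alpha x^\alpha\in R$ put $\exp(f)=\max_\preceq\{\alpha: c_\alpha\neq0\}$, and $\exp(0)=-\infty$. Assume that $R$ is a left PBW ring with respect to $\preceq$, that is, $\exp(fg)=\exp(f)+\exp(g)$ for all $f,g\in R$. Let $q_{\alpha,\beta}\in D$ be the coefficient of $x^{\alpha+\beta}$ in $x^\alpha x^\beta$. Let $\mathbb N^n$ act on $\mathbb N^{n,(m)}=\mathbb N^n\times\{1,\dots,m\}$ by $(\alpha,i)+\beta=(\alpha+\beta,i)$, and fix an extension of $\preceq$ to an admissible order on $\mathbb N^{n,(m)}$, again written $\preceq$: a total order with $u\preceq v\Rightarrow u+\gamma\preceq v+\gamma$ and $\alpha\preceq\beta\Rightarrow(\alpha,i)\preceq(\beta,i)$.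 For $0\neq\mathbf f=\sum c_{(\alpha,i)}x^\alpha\mathbf e_i\in R^m$ let $\exp(\mathbf f)=(\operatorname{sexp}(\mathbf f),\operatorname{level}(\mathbf f))$ be the largest $(\alpha,i)$ with $c_{(\alpha,i)}\ne0$ (and $\exp(0)=-\infty$); $\mathbf f$ is monic if its leading coefficient $c_{\exp(\mathbf f)}$ is $1$. A Gröbner basis of a left submodule $L\subseteq R^m$ is a finite set $G$ of nonzero elements of $L$ such that $\{\exp(\mathbf f):0\ne\mathbf f\in L\}=\bigcup_{\mathbf g\in G}(\exp(\mathbf g)+\mathbb N^n)$. For $F=(\mathbf f_1,\dots,\mathbf f_s)$ in $R^m$ (a matrix in $R^{s\times m}$ with rows $\mathbf f_i$) let ${}_R\langle F\rangle$ be the left submodule generated by the rows and $\operatorname{Syz}(F)=\{h\in R^s:\sum_i h_i\mathbf f_i=0\}$. Let $G=(\mathbf g_1,\dots,\mathbf g_t)$ consist of monic elements of $R^m$, and put $\alpha_i=\operatorname{sexp}(\mathbf g_i)$, $I=\{(i,j):i<j,\ \operatorname{level}(\mathbf g_i)=\operatorname{level}(\mathbf g_j)\}$, $$r_{ij}=q_{\alpha_i\vee\alpha_j-\alpha_i,\,\alpha_i}^{-1}\,x^{\alpha_i\vee\alpha_j-\alpha_i},\qquad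 SP(\mathbf g_i,\mathbf g_j)=r_{ij}\mathbf g_i-r_{ji}\mathbf g_j,$$ where $\vee$ is the componentwise maximum. Define $\preceq_G$ on $\mathbb N^{n,(t)}$ by $(\alpha,i)\preceq_G(\beta,j)$ if and only if $\alpha+\exp(\mathbf g_i)\prec\beta+\exp(\mathbf g_j)$, or $\alpha+\exp(\mathbf g_i)=\beta+\exp(\mathbf g_j)$ and $j\le i$. 1. Suppose that $G$ is a Gröbner basis of ${}_R\langle G\rangle$. Then $\preceq_G$ is an admissible order on $\mathbb N^{n,(t)}$ extending $\preceq$. There are $h_{ijk}\in R$ ($(i,j)\in I$, $1\le k\le t$) with $$SP(\mathbf g_i,\mathbf g_j)=\sum_{k=1}^t h_{ijk}\mathbf g_k,\qquad \max_k\{\exp(h_{ijk})+\exp(\mathbf g_k)\}=\exp(SP(\mathbf g_i,\mathbf g_j)),$$ and for every such choice the set $S$ of the Schreyer syzygies $$\mathbf s_{ij}=r_{ij}\mathbf e'_i-r_{ji}\mathbf e'_j-\sum_{k=1}^t h_{ijk}\mathbf e'_k\qquad((i,j)\in I),$$ where $\mathbf e'_1,\dots,\mathbf e'_t$ is the canonical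 basis of $R^t$, is a Gröbner basis of $\operatorname{Syz}(G)$ with respect to $\preceq_G$. 2. For every $F\in R^{s\times m}$ there are a $t$, a matrix $G\in R^{t\times m}$ with monic rows that form a Gröbner basis of ${}_R\langle F\rangle$, and matrices $P\in R^{t\times s}$, $\hat P\in R^{s\times t}$ with $G=PF$ and $F=\hat PG$. For all such $G,P,\hat P$ and every choice of $h_{ijk}$ as in 1, if $\mathsf{syz}(G)$ denotes the matrix with rows $\mathbf s_{ij}$, $(i,j)\in I$, then the rows of $$\mathsf{syz}(F)=\begin{pmatrix}\mathsf{syz}(G)\,P\\ I_s-\hat PP\end{pmatrix}$$ generate the left $R$-module $\operatorname{Syz}(F)$. -/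

import Mathlib

namespace PBW

/-- The maximum of a set `s` with respect to a total order `le`, with value `⊥` (that is, `-∞`)
if there is none; for finite `s` this happens only when `s` is empty. -/
noncomputable def maxOf {σ : Type*} (le : σ → σ → Prop) (s : Set σ) : WithBot σ :=
  open Classical in
  if h : ∃ u, u ∈ s ∧ ∀ v ∈ s, le v u then (h.choose : WithBot σ) else ⊥

theorem maxOf_eq_coe_iff {σ : Type*} {le : σ → σ → Prop}
    (anti : ∀ u v, le u v → le v u → u = v) (s : Set σ) (u : σ) :
    maxOf le s = (u : WithBot σ) ↔ u ∈ s ∧ ∀ v ∈ s, le v u := by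
  unfold maxOf
  split_ifs with h
  · rw [WithBot.coe_inj]
    constructor
    · rintro rfl
      exact h.choose_spec
    · intro hu
      exact anti _ _ (hu.2 _ h.choose_spec.1) (h.choose_spec.2 _ hu.1)
  · constructor
    · intro h'
      exact absurd h' WithBot.bot_ne_coe
    · intro hu
      exact absurd ⟨u, hu⟩ h

/-- The order `le` extended by `-∞` as least element. -/
def botLE {σ : Type*} (le : σ → σ → Prop) (a b : WithBot σ) : Prop :=
  ∀ u : σ, a = (u : WithBot σ) → ∃ v : σ, b = (v : WithBot σ) ∧ le u v

/-- `le` is a total (linear) order. -/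
structure IsTotalOrder {σ : Type*} (le : σ → σ → Prop) : Prop where
  refl : ∀ u, le u u
  trans : ∀ u v w, le u v → le v w → le u w
  antisymm : ∀ u v, le u v → le v u → u = v
  total : ∀ u v, le u v ∨ le v u

/-- Admissible orders on `ℕⁿ`. -/
structure IsAdmissible {n : ℕ} (le : (Fin n → ℕ) → (Fin n → ℕ) → Prop) : Prop
    extends IsTotalOrder le where
  zero_le : ∀ α, le 0 α
  add_le_add : ∀ α β γ, le α β → le (α + γ) (β + γ)

/-- The index set `ℕⁿ × {1, …, m}` of the standard monomials `x^α e_i` of `R^m`. -/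
abbrev Idx (n m : ℕ) : Type := (Fin n → ℕ) × Fin m

/-- The action `(α, i) + β = (α + β, i)` of `ℕⁿ` on `ℕⁿ × {1, …, m}`. -/
def shift {n m : ℕ} (u : Idx n m) (β : Fin n → ℕ) : Idx n m := (u.1 + β, u.2)

/-- The action extended to `-∞`, with `-∞ + u = u + (-∞) = -∞`. -/
def botShift {n m : ℕ} (u : WithBot (Idx n m)) (β : WithBot (Fin n → ℕ)) : WithBot (Idx n m) :=
  WithBot.map₂ shift u β

/-- Admissible orders on `ℕⁿ × {1, …, m}` extending the order `le` on `ℕⁿ` (for instance TOP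
and POT): total orders, compatible with the action of `ℕⁿ`, that restrict to `le` on each
level. -/
structure IsAdmissibleExtension {n m : ℕ} (le : (Fin n → ℕ) → (Fin n → ℕ) → Prop)
    (leM : Idx n m → Idx n m → Prop) : Prop extends IsTotalOrder leM where
  level_le : ∀ α β i, le α β → leM (α, i) (β, i)
  shift_le_shift : ∀ u v γ, leM u v → leM (shift u γ) (shift v γ)

/-- The standard monomial `x^α = x_1^{α_1} ⋯ x_n^{α_n}`, the factors taken in this order. -/
def stdMonomial {R : Type*} [Ring R] {n : ℕ} (x : Fin n → R) (α : Fin n → ℕ) : R :=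
  (List.ofFn fun i => x i ^ α i).prod

/-- `R` is a left polynomial ring over the skew field `D` in `x_1, …, x_n`: every element has a
unique standard representation `∑ c_α x^α` with `c_α ∈ D`. The inclusion of `D` in `R` is the
ring homomorphism `ι`; uniqueness of the representations makes it injective. -/
structure LeftPolynomialRing (D R : Type*) [DivisionRing D] [Ring R] (n : ℕ) where
  ι : D →+* R
  x : Fin n → R
  existsUnique_rep : ∀ f : R, ∃! c : (Fin n → ℕ) →₀ D,
    f = c.sum fun α a => ι a * stdMonomial x α

/-- The module of syzygies of `f_1, …, f_s` in `R^m`: all `(h_1, …, h_s)` in `R^s` with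
`∑ h_i f_i = 0`. -/
def Syz {R : Type*} [Ring R] {s m : ℕ} (F : Fin s → Fin m → R) : Submodule R (Fin s → R) :=
  LinearMap.ker (Fintype.linearCombination R F)

namespace LeftPolynomialRing

variable {D R : Type*} [DivisionRing D] [Ring R] {n : ℕ} (A : LeftPolynomialRing D R n)

/-- `A.coeff f α` is the coefficient `c_α` in the standard representation of `f`. -/
noncomputable def coeff (f : R) : (Fin n → ℕ) →₀ D := (A.existsUnique_rep f).choose

/-- The exponent of `f ∈ R`; it is `⊥` for `f = 0`. -/
noncomputable def exp (le : (Fin n → ℕ) → (Fin n → ℕ) → Prop) (f : R) : WithBot (Fin n → ℕ) :=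
  maxOf le {α | A.coeff f α ≠ 0}

/-- `R` is a left PBW ring with respect to `le`: exponents are additive on products. -/
def IsLeftPBW (le : (Fin n → ℕ) → (Fin n → ℕ) → Prop) : Prop :=
  ∀ f g : R, A.exp le (f * g) = A.exp le f + A.exp le g

/-- The coefficient of `x^α e_i` in the standard representation of `f ∈ R^m`. -/
noncomputable def vecCoeff {m : ℕ} (f : Fin m → R) (u : Idx n m) : D := A.coeff (f u.2) u.1

/-- The Newton diagram of `f ∈ R^m`. -/
def newton {m : ℕ} (f : Fin m → R) : Set (Idx n m) := {u | A.vecCoeff f u ≠ 0}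

/-- The exponent of `f ∈ R^m` with respect to `leM`; it is `⊥` for `f = 0`. -/
noncomputable def vecExp {m : ℕ} (leM : Idx n m → Idx n m → Prop) (f : Fin m → R) :
    WithBot (Idx n m) :=
  maxOf leM (A.newton f)

/-- The scalar exponent of `f ∈ R^m` (only used for `f ≠ 0`). -/
noncomputable def sexp {m : ℕ} (leM : Idx n m → Idx n m → Prop) (f : Fin m → R) : Fin n → ℕ :=
  ((A.vecExp leM f).map Prod.fst).unbotD 0

/-- The level of `f ∈ R^m`; it is `⊥` for `f = 0`. -/
noncomputable def level {m : ℕ} (leM : Idx n m → Idx n m → Prop) (f : Fin m → R) :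
    WithBot (Fin m) :=
  (A.vecExp leM f).map Prod.snd

/-- `f ∈ R^m` is monic: it is nonzero with leading coefficient `1`. -/
def IsMonic {m : ℕ} (leM : Idx n m → Idx n m → Prop) (f : Fin m → R) : Prop :=
  ∃ u : Idx n m, A.vecExp leM f = (u : WithBot (Idx n m)) ∧ A.vecCoeff f u = 1

/-- `Exp(L)`, the set of the exponents of the nonzero elements of `L`. -/
def Exp {m : ℕ} (leM : Idx n m → Idx n m → Prop) (L : Submodule R (Fin m → R)) :
    Set (Idx n m) :=
  {u | ∃ f ∈ L, f ≠ 0 ∧ A.vecExp leM f = (u : WithBot (Idx n m))}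

/-- `G` is a Gröbner basis of `L` with respect to `leM`: a finite set of nonzero elements of `L`
such that `Exp(L)` is the union of the sets `exp(g) + ℕⁿ`, `g ∈ G`. -/
structure IsGroebnerBasis {m : ℕ} (leM : Idx n m → Idx n m → Prop) (G : Set (Fin m → R))
    (L : Submodule R (Fin m → R)) : Prop where
  finite : G.Finite
  subset : ∀ g ∈ G, g ∈ L
  ne_zero : ∀ g ∈ G, g ≠ 0
  exp_eq : A.Exp leM L = {w | ∃ g ∈ G, ∃ (u : Idx n m) (β : Fin n → ℕ),
    A.vecExp leM g = (u : WithBot (Idx n m)) ∧ w = shift u β}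

/-- The coefficient `q_{α,β}` in `x^α x^β = q_{α,β} x^{α+β} + p_{α,β}`,
`exp(p_{α,β}) ≺ α + β`. -/
noncomputable def q (α β : Fin n → ℕ) : D :=
  A.coeff (stdMonomial A.x α * stdMonomial A.x β) (α + β)

section Schreyer

variable {m t : ℕ} (leM : Idx n m → Idx n m → Prop) (g : Fin t → Fin m → R)

/-- The monomial `r_{ij} = q_{α_i ∨ α_j - α_i, α_i}⁻¹ x^{α_i ∨ α_j - α_i}` in `R`, where
`α_i = sexp(g_i)`. -/
noncomputable def r (i j : Fin t) : R :=
  let α := A.sexp leM (g i)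
  let β := A.sexp leM (g j)
  A.ι (A.q (α ⊔ β - α) α)⁻¹ * stdMonomial A.x (α ⊔ β - α)

/-- `SP(g_i, g_j) = r_{ij} g_i - r_{ji} g_j`. -/
noncomputable def SP (i j : Fin t) : Fin m → R :=
  A.r leM g i j • g i - A.r leM g j i • g j

/-- The set `I` of the pairs `(i, j)` with `i < j` and `level(g_i) = level(g_j)`. -/
abbrev Pairs : Type :=
  {p : Fin t × Fin t // p.1 < p.2 ∧ A.level leM (g p.1) = A.level leM (g p.2)}

/-- `h_{ijk}`, for `(i, j) ∈ I` and `1 ≤ k ≤ t`, are such that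
`SP(g_i, g_j) = ∑_k h_{ijk} g_k` and `max_k {exp(h_{ijk}) + exp(g_k)} = exp(SP(g_i, g_j))`. -/
def IsSchreyerQuotient (le : (Fin n → ℕ) → (Fin n → ℕ) → Prop)
    (h : A.Pairs leM g → Fin t → R) : Prop :=
  ∀ p : A.Pairs leM g,
    A.SP leM g p.1.1 p.1.2 = ∑ k, h p k • g k ∧
    maxOf leM {u | ∃ k, botShift (A.vecExp leM (g k)) (A.exp le (h p k)) =
      (u : WithBot (Idx n m))} = A.vecExp leM (A.SP leM g p.1.1 p.1.2)

/-- The matrix with rows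
`s_{ij} = r_{ij} e'_i - r_{ji} e'_j - ∑_k h_{ijk} e'_k`, for `(i, j) ∈ I`. -/
noncomputable def schreyerSyz (h : A.Pairs leM g → Fin t → R) :
    Matrix (A.Pairs leM g) (Fin t) R :=
  Matrix.of fun p => Pi.single p.1.1 (A.r leM g p.1.1 p.1.2)
    - Pi.single p.1.2 (A.r leM g p.1.2 p.1.1) - ∑ k, Pi.single k (h p k)

/-- The order `≼_G` on `ℕⁿ × {1, …, t}` induced by `g_1, …, g_t`: `(α, i) ≼_G (β, j)` if
`α + exp(g_i) ≺ β + exp(g_j)`, or `α + exp(g_i) = β + exp(g_j)` and `j ≤ i`. -/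
def schreyerLE (u v : Idx n t) : Prop :=
  let a := botShift (A.vecExp leM (g u.2)) (u.1 : WithBot (Fin n → ℕ))
  let b := botShift (A.vecExp leM (g v.2)) (v.1 : WithBot (Fin n → ℕ))
  (botLE leM a b ∧ a ≠ b) ∨ (a = b ∧ v.2 ≤ u.2)

end Schreyer

end LeftPolynomialRing

end PBW

/-!
Division is possible in `R^m` because exponents are additive (`vecExp_smul`): a term multiple of
`g` removes the leading term of `f` whenever `exp(g)` divides `exp(f)`. By Dickson's lemma every
submodule has a finite Gröbner basis (`exists_isGroebnerBasis`), and an admissible order on the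
monomials is well-founded, so that division by a Gröbner basis terminates
(`IsGroebnerBasis.exists_quotient`). Applied to the elements `SP(g_i, g_j)`, this yields the
quotients `h_{ijk}`; in general it shows that a Gröbner basis generates its submodule.

For Schreyer's theorem, the exponent of `s_{ij}` with respect to the induced order is
`(α_i ∨ α_j - α_i, i)` (`vecExp_schreyerSyz`): both `r_{ij} g_i` and `r_{ji} g_j` are monic with the
same exponent, hence `SP(g_i, g_j)` and the terms `h_{ijk} g_k` lie strictly below it, and the tie
between `r_{ij} e'_i` and `r_{ji} e'_j` is decided by `i < j`. Conversely, let `(α, i)` be the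
exponent of a syzygy `f` of `G`. The exponent `α + exp(g_i)` of `f_i g_i` is the largest one in the
vanishing sum `∑ f_k g_k`, so it occurs as the exponent of another summand `f_j g_j`, and `i < j` by
the choice of `i`. Thus `g_i` and `g_j` have the same level and `α_i ∨ α_j` divides `α + α_i`: the
exponent of `s_{ij}` divides `(α, i)` (`exists_pair_of_mem_syz`).

The last part is linear algebra. If `G = P F` and `F = Q G`, a syzygy `h` of `F` is
`(h Q) P + h (1 - Q P)`, and `h Q` is a syzygy of `G`, hence a combination of the `s_{ij}`
(`span_fromRows_eq_Syz`).
-/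

namespace PBW

/-! ### Total orders and shifts of indices -/

section Order

variable {σ : Type*} {le : σ → σ → Prop}

theorem IsTotalOrder.exists_max (h : IsTotalOrder le) {s : Set σ} (hs : s.Finite)
    (hne : s.Nonempty) : ∃ u ∈ s, ∀ v ∈ s, le v u := by
  induction s, hs using Set.Finite.induction_on with
  | empty => exact absurd hne Set.not_nonempty_empty
  | @insert a s _ _ ih =>
    rcases s.eq_empty_or_nonempty with rfl | hs'
    · exact ⟨a, by simp, by simpa using h.refl a⟩
    · obtain ⟨u, hu, hmax⟩ := ih hs'
      rcases h.total a u with hau | hua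
      · refine ⟨u, Set.mem_insert_of_mem _ hu, ?_⟩
        rintro v (rfl | hv)
        exacts [hau, hmax v hv]
      · refine ⟨a, Set.mem_insert _ _, ?_⟩
        rintro v (rfl | hv)
        exacts [h.refl _, h.trans _ _ _ (hmax v hv) hua]

theorem maxOf_empty : maxOf le ∅ = ⊥ := by
  unfold maxOf
  rw [dif_neg]
  rintro ⟨u, hu, -⟩
  exact hu

theorem IsTotalOrder.exists_maxOf_eq (h : IsTotalOrder le) {s : Set σ} (hs : s.Finite)
    (hne : s.Nonempty) : ∃ u : σ, maxOf le s = u := by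
  obtain ⟨u, hu, hmax⟩ := h.exists_max hs hne
  exact ⟨u, (maxOf_eq_coe_iff h.antisymm s u).2 ⟨hu, hmax⟩⟩

theorem IsTotalOrder.wellFounded_of_wellQuasiOrdered (h : IsTotalOrder le) {r : σ → σ → Prop}
    (hr : WellQuasiOrdered r) (hle : ∀ u v, r u v → le u v) :
    WellFounded fun u v => le u v ∧ u ≠ v := by
  rw [wellFounded_iff_isEmpty_descending_chain]
  refine ⟨fun ⟨f, hf⟩ => ?_⟩
  have key : ∀ i k, le (f (i + 1 + k)) (f (i + 1)) := by
    intro i k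
    induction k with
    | zero => exact h.refl _
    | succ k ih => exact h.trans _ _ _ (hf _).1 ih
  obtain ⟨i, j, hij, hf'⟩ := hr f
  obtain ⟨k, rfl⟩ := Nat.exists_eq_add_of_lt hij
  rw [show i + k + 1 = i + 1 + k by omega] at hf'
  exact (hf i).2 (h.antisymm _ _ (hf i).1 (h.trans _ _ _ (hle _ _ hf') (key i k)))

end Order

section Shift

variable {n m : ℕ}

theorem shift_shift (u : Idx n m) (α β : Fin n → ℕ) :
    shift (shift u α) β = shift u (α + β) := by
  simp [shift, add_assoc]

theorem shift_left_injective (γ : Fin n → ℕ) :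
    Function.Injective fun u : Idx n m => shift u γ := by
  rintro ⟨α, i⟩ ⟨β, j⟩ h
  simpa [shift] using h

theorem shift_right_injective (u : Idx n m) : Function.Injective (shift u) := by
  intro α β h
  simpa [shift] using h

theorem botShift_coe_coe (u : Idx n m) (β : Fin n → ℕ) :
    botShift (u : WithBot (Idx n m)) (β : WithBot (Fin n → ℕ)) = (shift u β : Idx n m) := rfl

theorem botShift_coe_eq_coe_iff (u v : Idx n m) (b : WithBot (Fin n → ℕ)) :
    botShift (u : WithBot (Idx n m)) b = v ↔ ∃ β : Fin n → ℕ, b = β ∧ shift u β = v := by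
  induction b using WithBot.recBotCoe with
  | bot =>
    constructor
    · intro h
      exact absurd h WithBot.bot_ne_coe
    · rintro ⟨β, h, -⟩
      exact absurd h WithBot.bot_ne_coe
  | coe b => simp [botShift_coe_coe, WithBot.coe_inj]

/-- Dickson's lemma for the monomials of `R^m`. -/
theorem wellQuasiOrdered_shift :
    WellQuasiOrdered fun u v : Idx n m => ∃ β, v = shift u β := by
  intro f
  obtain ⟨i, j, hij, h1, h2⟩ :=
    (wellQuasiOrdered_le (α := Fin n → ℕ)).prod (Finite.wellQuasiOrdered (α := Fin m) (· = ·)) f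
  exact ⟨i, j, hij, (f j).1 - (f i).1, Prod.ext (add_tsub_cancel_of_le h1).symm h2.symm⟩

/-- Every set of monomials is generated, up to divisibility, by finitely many of its elements. -/
theorem exists_finset_shift (E : Set (Idx n m)) :
    ∃ B : Finset (Idx n m), ↑B ⊆ E ∧ ∀ v ∈ E, ∃ u ∈ B, ∃ β, v = shift u β := by
  by_contra! hcon
  -- Otherwise one may keep choosing elements of `E` that no earlier choice divides.
  obtain ⟨f, -, hf⟩ := exists_seq_of_forall_finset_exists (· ∈ E)
    (fun u v => ∀ β, v ≠ shift u β) fun s hs => hcon s fun u hu => hs u hu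
  obtain ⟨i, j, hij, β, hβ⟩ := wellQuasiOrdered_shift f
  exact hf i j hij β hβ

variable {le : (Fin n → ℕ) → (Fin n → ℕ) → Prop} {leM : Idx n m → Idx n m → Prop}

theorem IsAdmissibleExtension.le_shift (hM : IsAdmissibleExtension le leM)
    (hle : IsAdmissible le) (u : Idx n m) (β : Fin n → ℕ) : leM u (shift u β) := by
  have := hle.add_le_add 0 β u.1 (hle.zero_le β)
  rw [zero_add, add_comm] at this
  exact hM.level_le _ _ u.2 this

theorem IsAdmissibleExtension.wellFounded (hM : IsAdmissibleExtension le leM)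
    (hle : IsAdmissible le) : WellFounded fun u v => leM u v ∧ u ≠ v := by
  refine hM.wellFounded_of_wellQuasiOrdered wellQuasiOrdered_shift ?_
  rintro u _ ⟨β, rfl⟩
  exact hM.le_shift hle u β

end Shift

namespace LeftPolynomialRing

variable {D R : Type*} [DivisionRing D] [Ring R] {n : ℕ} (A : LeftPolynomialRing D R n)

/-! ### Coefficients -/

theorem coeff_spec (f : R) : f = (A.coeff f).sum fun α a => A.ι a * stdMonomial A.x α :=
  (A.existsUnique_rep f).choose_spec.1

theorem coeff_eq_of_rep {f : R} {c : (Fin n → ℕ) →₀ D}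
    (h : f = c.sum fun α a => A.ι a * stdMonomial A.x α) : A.coeff f = c :=
  ((A.existsUnique_rep f).choose_spec.2 c h).symm

theorem coeff_add (f g : R) : A.coeff (f + g) = A.coeff f + A.coeff g := by
  apply A.coeff_eq_of_rep
  rw [Finsupp.sum_add_index' (by simp) (by simp [add_mul]), ← A.coeff_spec f, ← A.coeff_spec g]

theorem coeff_ι_mul (a : D) (f : R) : A.coeff (A.ι a * f) = a • A.coeff f := by
  apply A.coeff_eq_of_rep
  rw [Finsupp.sum_smul_index (by simp)]
  conv_lhs => rw [A.coeff_spec f, Finsupp.mul_sum]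
  simp [mul_assoc]

theorem coeff_stdMonomial (α : Fin n → ℕ) :
    A.coeff (stdMonomial A.x α) = Finsupp.single α 1 := by
  apply A.coeff_eq_of_rep
  rw [Finsupp.sum_single_index (by simp)]
  simp

/-- `A.coeff` as an additive map. -/
noncomputable def coeffHom : R →+ ((Fin n → ℕ) →₀ D) := AddMonoidHom.mk' A.coeff A.coeff_add

theorem coeff_zero : A.coeff 0 = 0 := A.coeffHom.map_zero

theorem coeff_sub (f g : R) : A.coeff (f - g) = A.coeff f - A.coeff g := A.coeffHom.map_sub f g

theorem coeff_eq_zero_iff (f : R) : A.coeff f = 0 ↔ f = 0 := by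
  refine ⟨fun h => ?_, fun h => by rw [h, coeff_zero]⟩
  rw [A.coeff_spec f, h, Finsupp.sum_zero_index]

variable {m : ℕ}

/-- `A.vecCoeff · u` as an additive map. -/
noncomputable def vecCoeffHom (u : Idx n m) : (Fin m → R) →+ D :=
  (Finsupp.applyAddHom u.1).comp (A.coeffHom.comp (Pi.evalAddMonoidHom (fun _ => R) u.2))

theorem vecCoeff_sub (f g : Fin m → R) (u : Idx n m) :
    A.vecCoeff (f - g) u = A.vecCoeff f u - A.vecCoeff g u := (A.vecCoeffHom u).map_sub f g

theorem vecCoeff_zero (u : Idx n m) : A.vecCoeff (0 : Fin m → R) u = 0 :=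
  (A.vecCoeffHom u).map_zero

theorem vecCoeff_sum {κ : Type*} (s : Finset κ) (f : κ → Fin m → R) (u : Idx n m) :
    A.vecCoeff (∑ k ∈ s, f k) u = ∑ k ∈ s, A.vecCoeff (f k) u := map_sum (A.vecCoeffHom u) f s

theorem vecCoeff_ι_mul_smul (a : D) (b : R) (f : Fin m → R) (u : Idx n m) :
    A.vecCoeff ((A.ι a * b) • f) u = a * A.vecCoeff (b • f) u := by
  simp [vecCoeff, mul_assoc, coeff_ι_mul]

theorem finite_newton (f : Fin m → R) : (A.newton f).Finite := by
  refine (Set.finite_iUnion fun i : Fin m =>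
    ((A.coeff (f i)).support.finite_toSet.image fun α => (α, i))).subset ?_
  rintro ⟨α, i⟩ hu
  exact Set.mem_iUnion.2 ⟨i, α, by simpa [newton, vecCoeff] using hu, rfl⟩

theorem newton_nonempty {f : Fin m → R} (hf : f ≠ 0) : (A.newton f).Nonempty := by
  obtain ⟨i, hi⟩ := Function.ne_iff.1 hf
  obtain ⟨α, hα⟩ := Finsupp.ne_iff.1 (mt (A.coeff_eq_zero_iff (f i)).1 hi)
  exact ⟨(α, i), hα⟩

/-! ### Exponents -/

variable {le : (Fin n → ℕ) → (Fin n → ℕ) → Prop} {leM : Idx n m → Idx n m → Prop}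

theorem exp_eq_coe_iff (hle : IsTotalOrder le) (f : R) (α : Fin n → ℕ) :
    A.exp le f = α ↔ A.coeff f α ≠ 0 ∧ ∀ β, A.coeff f β ≠ 0 → le β α :=
  maxOf_eq_coe_iff hle.antisymm _ _

theorem exp_zero : A.exp le 0 = ⊥ := by
  simp [exp, coeff_zero, maxOf_empty]

theorem exists_exp_eq (hle : IsTotalOrder le) {f : R} (hf : f ≠ 0) :
    ∃ α : Fin n → ℕ, A.exp le f = α := by
  refine hle.exists_maxOf_eq ?_ (Finsupp.ne_iff.1 (mt (A.coeff_eq_zero_iff f).1 hf))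
  exact (A.coeff f).support.finite_toSet.subset fun α hα => by simpa using hα

theorem vecExp_eq_coe_iff (hM : IsTotalOrder leM) (f : Fin m → R) (u : Idx n m) :
    A.vecExp leM f = u ↔ A.vecCoeff f u ≠ 0 ∧ ∀ v, A.vecCoeff f v ≠ 0 → leM v u :=
  maxOf_eq_coe_iff hM.antisymm _ _

theorem vecExp_zero : A.vecExp leM (0 : Fin m → R) = ⊥ := by
  simp [vecExp, newton, vecCoeff_zero, maxOf_empty]

theorem exists_vecExp_eq (hM : IsTotalOrder leM) {f : Fin m → R} (hf : f ≠ 0) :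
    ∃ u : Idx n m, A.vecExp leM f = u :=
  hM.exists_maxOf_eq (A.finite_newton f) (A.newton_nonempty hf)

theorem ne_zero_of_vecExp_eq {f : Fin m → R} {u : Idx n m} (h : A.vecExp leM f = u) :
    f ≠ 0 := by
  rintro rfl
  exact WithBot.bot_ne_coe (A.vecExp_zero.symm.trans h)

theorem coeff_ι_mul_stdMonomial_ne_zero_iff {a : D} (ha : a ≠ 0) (α β : Fin n → ℕ) :
    A.coeff (A.ι a * stdMonomial A.x α) β ≠ 0 ↔ β = α := by
  rw [coeff_ι_mul, coeff_stdMonomial, Finsupp.smul_single, smul_eq_mul, mul_one,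
    Finsupp.single_apply_ne_zero]
  exact ⟨fun h => h.1, fun h => ⟨h, ha⟩⟩

theorem exp_stdMonomial (hle : IsTotalOrder le) (α : Fin n → ℕ) :
    A.exp le (stdMonomial A.x α) = α := by
  have key := A.coeff_ι_mul_stdMonomial_ne_zero_iff one_ne_zero α
  simp only [map_one, one_mul] at key
  refine (A.exp_eq_coe_iff hle _ _).2 ⟨(key α).2 rfl, fun β hβ => ?_⟩
  rw [(key β).1 hβ]
  exact hle.refl α

/-- The component of `f` at the level of its exponent has the scalar exponent of `f`. -/
theorem exp_apply_level (hle : IsAdmissible le) (hM : IsAdmissibleExtension le leM)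
    {f : Fin m → R} {u : Idx n m} (h : A.vecExp leM f = u) : A.exp le (f u.2) = u.1 := by
  obtain ⟨h0, hmax⟩ := (A.vecExp_eq_coe_iff hM.toIsTotalOrder _ _).1 h
  refine (A.exp_eq_coe_iff hle.toIsTotalOrder _ _).2 ⟨h0, fun β hβ => ?_⟩
  rcases hle.total β u.1 with h1 | h1
  · exact h1
  · have := hM.antisymm _ _ (hmax (β, u.2) hβ) (hM.level_le _ _ u.2 h1)
    rw [← this]
    exact hle.refl _

theorem exp_mul_coe (hA : A.IsLeftPBW le) {a b : R} {α β : Fin n → ℕ}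
    (ha : A.exp le a = α) (hb : A.exp le b = β) :
    A.exp le (a * b) = (α + β : Fin n → ℕ) := by
  rw [hA, ha, hb, WithBot.coe_add]

/-- Additivity of exponents for the action of `R` on `R^m`. -/
theorem vecExp_smul (hle : IsAdmissible le) (hA : A.IsLeftPBW le)
    (hM : IsAdmissibleExtension le leM) {a : R} {β : Fin n → ℕ} (ha : A.exp le a = β)
    {f : Fin m → R} {u : Idx n m} (hf : A.vecExp leM f = u) :
    A.vecExp leM (a • f) = (shift u β : Idx n m) := by
  have hmax := ((A.vecExp_eq_coe_iff hM.toIsTotalOrder _ _).1 hf).2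
  refine (A.vecExp_eq_coe_iff hM.toIsTotalOrder _ _).2 ⟨?_, ?_⟩
  · have h := A.exp_mul_coe hA ha (A.exp_apply_level hle hM hf)
    rw [add_comm] at h
    exact ((A.exp_eq_coe_iff hle.toIsTotalOrder _ _).1 h).1
  · rintro ⟨γ, j⟩ hv
    have hv' : A.coeff (a * f j) γ ≠ 0 := hv
    have hfj : f j ≠ 0 := by
      intro h0
      rw [h0, mul_zero, coeff_zero] at hv'
      exact hv' rfl
    obtain ⟨α, hα⟩ := A.exists_exp_eq hle.toIsTotalOrder hfj
    have h1 := ((A.exp_eq_coe_iff hle.toIsTotalOrder _ _).1 (A.exp_mul_coe hA ha hα)).2 γ hv'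
    rw [add_comm] at h1
    have h2 : leM (α, j) u := hmax _ ((A.exp_eq_coe_iff hle.toIsTotalOrder _ _).1 hα).1
    exact hM.trans _ _ _ (hM.level_le _ _ j h1) (hM.shift_le_shift _ _ β h2)

theorem exists_exp_eq_of_vecCoeff_smul_ne_zero (hle : IsTotalOrder le) {a : R} {f : Fin m → R}
    {v : Idx n m} (h : A.vecCoeff (a • f) v ≠ 0) : ∃ β : Fin n → ℕ, A.exp le a = β := by
  refine A.exists_exp_eq hle ?_
  rintro rfl
  rw [zero_smul, vecCoeff_zero] at h
  exact h rfl

/-! ### Gröbner bases: existence and division -/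

/-- The exponents of a submodule are stable under the action of `ℕⁿ`. -/
theorem shift_mem_Exp (hle : IsAdmissible le) (hA : A.IsLeftPBW le)
    (hM : IsAdmissibleExtension le leM) {L : Submodule R (Fin m → R)} {f : Fin m → R}
    (hf : f ∈ L) {u : Idx n m} (hu : A.vecExp leM f = u) (β : Fin n → ℕ) :
    shift u β ∈ A.Exp leM L := by
  have h := A.vecExp_smul hle hA hM (A.exp_stdMonomial hle.toIsTotalOrder β) hu
  exact ⟨_, L.smul_mem _ hf, A.ne_zero_of_vecExp_eq h, h⟩

theorem exists_isMonic_mem (hM : IsTotalOrder leM) {L : Submodule R (Fin m → R)} {u : Idx n m}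
    (hu : u ∈ A.Exp leM L) :
    ∃ f ∈ L, A.vecExp leM f = u ∧ A.vecCoeff f u = 1 := by
  obtain ⟨f, hfL, -, hf⟩ := hu
  obtain ⟨h0, hmax⟩ := (A.vecExp_eq_coe_iff hM _ _).1 hf
  have hc : ∀ v, A.vecCoeff ((A.ι (A.vecCoeff f u)⁻¹) • f) v
      = (A.vecCoeff f u)⁻¹ * A.vecCoeff f v := by
    intro v
    have := A.vecCoeff_ι_mul_smul (A.vecCoeff f u)⁻¹ 1 f v
    rwa [mul_one, one_smul] at this
  refine ⟨_, L.smul_mem (A.ι (A.vecCoeff f u)⁻¹) hfL, ?_, ?_⟩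
  · refine (A.vecExp_eq_coe_iff hM _ _).2 ⟨?_, fun v hv => hmax v ?_⟩
    · rw [hc]
      exact mul_ne_zero (inv_ne_zero h0) h0
    · rw [hc] at hv
      exact right_ne_zero_of_mul hv
  · rw [hc, inv_mul_cancel₀ h0]

/-- Every submodule of `R^m` has a Gröbner basis consisting of monic elements. -/
theorem exists_isGroebnerBasis (hle : IsAdmissible le) (hA : A.IsLeftPBW le)
    (hM : IsAdmissibleExtension le leM) (L : Submodule R (Fin m → R)) :
    ∃ (t : ℕ) (g : Fin t → Fin m → R), (∀ i, A.IsMonic leM (g i)) ∧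
      A.IsGroebnerBasis leM (Set.range g) L := by
  obtain ⟨B, hBE, hB⟩ := exists_finset_shift (A.Exp leM L)
  choose f hfL hfexp hf1 using fun u : B => A.exists_isMonic_mem hM.toIsTotalOrder (hBE u.2)
  refine ⟨B.card, fun i => f (B.equivFin.symm i), fun i => ⟨_, hfexp _, hf1 _⟩,
    Set.finite_range _, ?_, ?_, ?_⟩
  · rintro _ ⟨i, rfl⟩
    exact hfL _
  · rintro _ ⟨i, rfl⟩
    exact A.ne_zero_of_vecExp_eq (hfexp _)
  · ext w
    constructor
    · intro hw
      obtain ⟨u, hu, β, rfl⟩ := hB w hw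
      refine ⟨f ⟨u, hu⟩, ⟨B.equivFin ⟨u, hu⟩, by simp⟩, u, β, hfexp _, rfl⟩
    · rintro ⟨_, ⟨i, rfl⟩, u, β, hu, rfl⟩
      exact A.shift_mem_Exp hle hA hM (hfL _) hu β

/-- Leading term cancellation: a multiple of `g` by a term removes the leading term of `f`
whenever `exp(g)` divides `exp(f)`. -/
theorem exists_term_vecCoeff_sub (hle : IsAdmissible le) (hA : A.IsLeftPBW le)
    (hM : IsAdmissibleExtension le leM) {f g : Fin m → R} {u : Idx n m} {β : Fin n → ℕ}
    (hg : A.vecExp leM g = u) (hf : A.vecExp leM f = (shift u β : Idx n m)) :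
    ∃ c : R, (∀ γ, A.coeff c γ ≠ 0 → γ = β) ∧
      ∀ v, A.vecCoeff (f - c • g) v ≠ 0 → leM v (shift u β) ∧ v ≠ shift u β := by
  obtain ⟨hf0, hfmax⟩ := (A.vecExp_eq_coe_iff hM.toIsTotalOrder _ _).1 hf
  obtain ⟨hg0, hgmax⟩ := (A.vecExp_eq_coe_iff hM.toIsTotalOrder _ _).1
    (A.vecExp_smul hle hA hM (A.exp_stdMonomial hle.toIsTotalOrder β) hg)
  set d := A.vecCoeff f (shift u β) * (A.vecCoeff (stdMonomial A.x β • g) (shift u β))⁻¹ with hd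
  have hd0 : d ≠ 0 := mul_ne_zero hf0 (inv_ne_zero hg0)
  refine ⟨A.ι d * stdMonomial A.x β,
    fun γ => (A.coeff_ι_mul_stdMonomial_ne_zero_iff hd0 β γ).1, fun v hv => ?_⟩
  rw [vecCoeff_sub, vecCoeff_ι_mul_smul] at hv
  constructor
  · by_cases h : A.vecCoeff f v = 0
    · rw [h, zero_sub, neg_ne_zero] at hv
      exact hgmax v (right_ne_zero_of_mul hv)
    · exact hfmax v h
  · rintro rfl
    rw [hd, inv_mul_cancel_right₀ hg0, sub_self] at hv
    exact hv rfl

variable {t : ℕ} {g : Fin t → Fin m → R} {e : Fin t → Idx n m}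

/-- Division by a Gröbner basis, by well-founded recursion on the exponent `w` of `f`. The bound on
the quotients is on all their coefficients, not just on their exponents, so that it is visibly
stable under addition. -/
theorem IsGroebnerBasis.exists_quotient_of_vecExp_eq (hle : IsAdmissible le)
    (hA : A.IsLeftPBW le) (hM : IsAdmissibleExtension le leM)
    (he : ∀ i, A.vecExp leM (g i) = e i) {L : Submodule R (Fin m → R)}
    (hg : A.IsGroebnerBasis leM (Set.range g) L) (w : Idx n m) :
    ∀ f ∈ L, A.vecExp leM f = w → ∃ h : Fin t → R, f = ∑ k, h k • g k ∧
      ∀ k β, A.coeff (h k) β ≠ 0 → leM (shift (e k) β) w := by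
  induction w using (hM.wellFounded hle).induction with
  | _ w ih =>
  intro f hfL hf
  have hw : w ∈ A.Exp leM L := ⟨f, hfL, A.ne_zero_of_vecExp_eq hf, hf⟩
  rw [hg.exp_eq] at hw
  obtain ⟨_, ⟨k, rfl⟩, u, β, hu, rfl⟩ := hw
  obtain rfl : e k = u := WithBot.coe_injective ((he k).symm.trans hu)
  obtain ⟨c, hc, hlt⟩ := A.exists_term_vecCoeff_sub hle hA hM hu hf
  have hcL : f - c • g k ∈ L := L.sub_mem hfL (L.smul_mem _ (hg.subset _ ⟨k, rfl⟩))
  obtain ⟨h, hh, hb⟩ : ∃ h : Fin t → R, f - c • g k = ∑ k, h k • g k ∧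
      ∀ j γ, A.coeff (h j) γ ≠ 0 → leM (shift (e j) γ) (shift (e k) β) := by
    by_cases h0 : f - c • g k = 0
    · exact ⟨0, by simp [h0], fun j γ hγ => absurd (by simp [coeff_zero]) hγ⟩
    · obtain ⟨w', hw'⟩ := A.exists_vecExp_eq hM.toIsTotalOrder h0
      have hlt' := hlt w' ((A.vecExp_eq_coe_iff hM.toIsTotalOrder _ _).1 hw').1
      obtain ⟨h, hh, hb⟩ := ih w' hlt' _ hcL hw'
      exact ⟨h, hh, fun j γ hγ => hM.trans _ _ _ (hb j γ hγ) hlt'.1⟩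
  refine ⟨h + Pi.single k c, ?_, fun j γ hγ => ?_⟩
  · simp only [Pi.add_apply, add_smul, Finset.sum_add_distrib, ← hh]
    rw [Finset.sum_eq_single k (fun j _ hj => by simp [hj]) (by simp)]
    simp
  · by_cases hj : A.coeff (h j) γ = 0
    · rw [Pi.add_apply, coeff_add, Finsupp.add_apply, hj, zero_add] at hγ
      obtain rfl : j = k := by
        by_contra hne
        simp [hne, coeff_zero] at hγ
      rw [Pi.single_eq_same] at hγ
      rw [hc γ hγ]
      exact hM.refl _
    · exact hb j γ hj

/-- Division by a Gröbner basis: every element `f` of the submodule is a combination of the basis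
in which no summand has a larger exponent than `f`. -/
theorem IsGroebnerBasis.exists_quotient (hle : IsAdmissible le) (hA : A.IsLeftPBW le)
    (hM : IsAdmissibleExtension le leM)
    (he : ∀ i, A.vecExp leM (g i) = e i) {L : Submodule R (Fin m → R)}
    (hg : A.IsGroebnerBasis leM (Set.range g) L) {f : Fin m → R} (hf : f ∈ L) :
    ∃ h : Fin t → R, f = ∑ k, h k • g k ∧
      maxOf leM {u | ∃ k, botShift (A.vecExp leM (g k)) (A.exp le (h k)) =
        (u : WithBot (Idx n m))} = A.vecExp leM f := by
  simp only [he, botShift_coe_eq_coe_iff]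
  by_cases h0 : f = 0
  · subst h0
    exact ⟨0, by simp, by simp [exp_zero, vecExp_zero, maxOf_empty]⟩
  obtain ⟨w, hw⟩ := A.exists_vecExp_eq hM.toIsTotalOrder h0
  obtain ⟨h, hh, hb⟩ := hg.exists_quotient_of_vecExp_eq A hle hA hM he w f hf hw
  have hle_w : ∀ k (β : Fin n → ℕ), A.exp le (h k) = (β : WithBot (Fin n → ℕ)) →
      leM (shift (e k) β) w :=
    fun k β hβ => hb k β ((A.exp_eq_coe_iff hle.toIsTotalOrder _ _).1 hβ).1
  refine ⟨h, hh, ?_⟩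
  rw [hw, maxOf_eq_coe_iff hM.antisymm]
  constructor
  -- The coefficient of `f` at `w` comes from some summand, whose exponent is then at least `w`.
  · have hw0 := ((A.vecExp_eq_coe_iff hM.toIsTotalOrder _ _).1 hw).1
    rw [hh, vecCoeff_sum] at hw0
    obtain ⟨k, -, hk⟩ := Finset.exists_ne_zero_of_sum_ne_zero hw0
    obtain ⟨β, hβ⟩ := A.exists_exp_eq_of_vecCoeff_smul_ne_zero hle.toIsTotalOrder hk
    have := ((A.vecExp_eq_coe_iff hM.toIsTotalOrder _ _).1
      (A.vecExp_smul hle hA hM hβ (he k))).2 w hk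
    exact ⟨k, β, hβ, hM.antisymm _ _ (hle_w k β hβ) this⟩
  · rintro _ ⟨k, β, hβ, rfl⟩
    exact hle_w k β hβ

theorem IsGroebnerBasis.span_eq (hle : IsAdmissible le) (hA : A.IsLeftPBW le)
    (hM : IsAdmissibleExtension le leM) {G : Set (Fin m → R)} {L : Submodule R (Fin m → R)}
    (hG : A.IsGroebnerBasis leM G L) : Submodule.span R G = L := by
  refine le_antisymm (Submodule.span_le.2 hG.subset) fun f hf => ?_
  obtain ⟨t, g, -, rfl⟩ := hG.finite.fin_param
  choose e he using fun i => A.exists_vecExp_eq hM.toIsTotalOrder (hG.ne_zero (g i) ⟨i, rfl⟩)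
  obtain ⟨h, rfl, -⟩ := hG.exists_quotient A hle hA hM he hf
  exact Submodule.sum_mem _ fun k _ => Submodule.smul_mem _ _ (Submodule.subset_span ⟨k, rfl⟩)

/-! ### The induced order on the syzygies -/

theorem schreyerLE_iff (he : ∀ i, A.vecExp leM (g i) = e i) (u v : Idx n t) :
    A.schreyerLE leM g u v ↔
      (leM (shift (e u.2) u.1) (shift (e v.2) v.1) ∧
        shift (e u.2) u.1 ≠ shift (e v.2) v.1) ∨
      (shift (e u.2) u.1 = shift (e v.2) v.1 ∧ v.2 ≤ u.2) := by
  have hbot : ∀ a b : Idx n m, botLE leM (a : WithBot (Idx n m)) b ↔ leM a b := by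
    intro a b
    constructor
    · intro h
      obtain ⟨v, hv, hle⟩ := h a rfl
      rwa [WithBot.coe_injective hv]
    · rintro h u hu
      exact ⟨b, rfl, by rwa [← WithBot.coe_injective hu]⟩
  simp only [schreyerLE, he, botShift_coe_coe, hbot, ne_eq, WithBot.coe_inj]

theorem isAdmissibleExtension_schreyerLE (hM : IsAdmissibleExtension le leM)
    (he : ∀ i, A.vecExp leM (g i) = e i) :
    IsAdmissibleExtension le (A.schreyerLE leM g) where
  refl u := (A.schreyerLE_iff he u u).2 (Or.inr ⟨rfl, le_rfl⟩)
  trans u v w := by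
    simp only [A.schreyerLE_iff he]
    rintro (⟨h1, h2⟩ | ⟨h1, h2⟩) (⟨h3, h4⟩ | ⟨h3, h4⟩)
    · refine Or.inl ⟨hM.trans _ _ _ h1 h3, fun h => h2 ?_⟩
      rw [← h] at h3
      exact hM.antisymm _ _ h1 h3
    · exact Or.inl (h3 ▸ ⟨h1, h2⟩)
    · exact Or.inl (h1 ▸ ⟨h3, h4⟩)
    · exact Or.inr ⟨h1.trans h3, h4.trans h2⟩
  antisymm u v := by
    simp only [A.schreyerLE_iff he]
    rintro (⟨h1, h2⟩ | ⟨h1, h2⟩) (⟨h3, h4⟩ | ⟨h3, h4⟩)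
    · exact absurd (hM.antisymm _ _ h1 h3) h2
    · exact absurd h3.symm h2
    · exact absurd h1.symm h4
    · have hi : u.2 = v.2 := le_antisymm h4 h2
      rw [hi] at h1
      exact Prod.ext (shift_right_injective _ h1) hi
  total u v := by
    simp only [A.schreyerLE_iff he]
    by_cases h : shift (e u.2) u.1 = shift (e v.2) v.1
    · rcases le_total u.2 v.2 with h' | h'
      · exact Or.inr (Or.inr ⟨h.symm, h'⟩)
      · exact Or.inl (Or.inr ⟨h, h'⟩)
    · rcases hM.total (shift (e u.2) u.1) (shift (e v.2) v.1) with h' | h'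
      · exact Or.inl (Or.inl ⟨h', h⟩)
      · exact Or.inr (Or.inl ⟨h', Ne.symm h⟩)
  level_le α β i h := by
    rw [A.schreyerLE_iff he]
    by_cases hαβ : α = β
    · exact Or.inr ⟨by rw [hαβ], le_rfl⟩
    · refine Or.inl ⟨?_, fun h' => hαβ (shift_right_injective _ h')⟩
      have := hM.shift_le_shift _ _ (e i).1 (hM.level_le _ _ (e i).2 h)
      simpa only [shift, add_comm] using this
  shift_le_shift u v γ := by
    simp only [A.schreyerLE_iff he]
    have hs : ∀ u : Idx n t, shift (e (shift u γ).2) (shift u γ).1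
        = shift (shift (e u.2) u.1) γ := fun u => (shift_shift _ _ _).symm
    rw [hs, hs]
    rintro (⟨h1, h2⟩ | ⟨h1, h2⟩)
    · exact Or.inl ⟨hM.shift_le_shift _ _ _ h1, fun h => h2 (shift_left_injective γ h)⟩
    · exact Or.inr ⟨by rw [h1], h2⟩

/-! ### Schreyer syzygies -/

theorem q_ne_zero (hle : IsTotalOrder le) (hA : A.IsLeftPBW le) (α β : Fin n → ℕ) :
    A.q α β ≠ 0 :=
  ((A.exp_eq_coe_iff hle _ _).1
    (A.exp_mul_coe hA (A.exp_stdMonomial hle α) (A.exp_stdMonomial hle β))).1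

/-- If the coefficient of `f` at its exponent `α` is `1`, then the leading coefficient of
`x^γ f` is `q_{γ,α}`. -/
theorem coeff_stdMonomial_mul (hle : IsAdmissible le) (hA : A.IsLeftPBW le) {f : R}
    {α : Fin n → ℕ} (hf : A.exp le f = α) (h1 : A.coeff f α = 1) (γ : Fin n → ℕ) :
    A.coeff (stdMonomial A.x γ * f) (γ + α) = A.q γ α := by
  have hα := (A.exp_eq_coe_iff hle.toIsTotalOrder _ _).1 hf
  -- The tail of `f` has a smaller exponent, so `x^γ` times it does not reach `γ + α`.
  have htail : A.coeff (stdMonomial A.x γ * (f - stdMonomial A.x α)) (γ + α) = 0 := by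
    by_cases h0 : f - stdMonomial A.x α = 0
    · simp [h0, coeff_zero]
    by_contra hne
    obtain ⟨δ, hδ⟩ := A.exists_exp_eq hle.toIsTotalOrder h0
    have h2 := (A.exp_eq_coe_iff hle.toIsTotalOrder _ _).1 hδ
    have h3 := (A.exp_eq_coe_iff hle.toIsTotalOrder _ _).1
      (A.exp_mul_coe hA (A.exp_stdMonomial hle.toIsTotalOrder γ) hδ)
    have h4 := h3.2 _ hne
    have hδα : δ ≠ α := by
      rintro rfl
      exact h2.1 (by simp [coeff_sub, coeff_stdMonomial, h1])
    have h5 : le δ α := by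
      refine hα.2 δ fun h => h2.1 ?_
      simp [coeff_sub, coeff_stdMonomial, h, hδα.symm]
    have h6 := hle.add_le_add _ _ γ h5
    rw [add_comm δ, add_comm α] at h6
    exact hδα (add_left_cancel (hle.antisymm _ _ h6 h4))
  rw [mul_sub, coeff_sub, Finsupp.sub_apply, sub_eq_zero] at htail
  exact htail

theorem sexp_eq {f : Fin m → R} {u : Idx n m} (h : A.vecExp leM f = u) :
    A.sexp leM f = u.1 := by
  simp [sexp, h]

theorem level_eq {f : Fin m → R} {u : Idx n m} (h : A.vecExp leM f = u) :
    A.level leM f = u.2 := by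
  simp [level, h]

theorem r_eq (he : ∀ i, A.vecExp leM (g i) = e i) (i j : Fin t) :
    A.r leM g i j = A.ι (A.q ((e i).1 ⊔ (e j).1 - (e i).1) (e i).1)⁻¹ *
      stdMonomial A.x ((e i).1 ⊔ (e j).1 - (e i).1) := by
  simp only [r, A.sexp_eq (he _)]

theorem coeff_r_ne_zero_iff (hle : IsTotalOrder le) (hA : A.IsLeftPBW le)
    (he : ∀ i, A.vecExp leM (g i) = e i) (i j : Fin t) (β : Fin n → ℕ) :
    A.coeff (A.r leM g i j) β ≠ 0 ↔ β = (e i).1 ⊔ (e j).1 - (e i).1 := by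
  rw [A.r_eq he]
  exact A.coeff_ι_mul_stdMonomial_ne_zero_iff (inv_ne_zero (A.q_ne_zero hle hA _ _)) _ _

/-- The multiple `r_{ij} g_i` has exponent `(α_i ∨ α_j, level(g_i))`. -/
theorem vecExp_r_smul (hle : IsAdmissible le) (hA : A.IsLeftPBW le)
    (hM : IsAdmissibleExtension le leM) (he : ∀ i, A.vecExp leM (g i) = e i) (i j : Fin t) :
    A.vecExp leM (A.r leM g i j • g i) = (((e i).1 ⊔ (e j).1, (e i).2) : Idx n m) := by
  have hr : A.exp le (A.r leM g i j) = ((e i).1 ⊔ (e j).1 - (e i).1 : Fin n → ℕ) := by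
    have key := A.coeff_r_ne_zero_iff hle.toIsTotalOrder hA he i j
    refine (A.exp_eq_coe_iff hle.toIsTotalOrder _ _).2 ⟨(key _).2 rfl, fun β hβ => ?_⟩
    rw [(key β).1 hβ]
    exact hle.refl _
  rw [A.vecExp_smul hle hA hM hr (he i), shift, add_tsub_cancel_of_le le_sup_left]

/-- The multiple `r_{ij} g_i` is monic if `g_i` is. -/
theorem vecCoeff_r_smul (hle : IsAdmissible le) (hA : A.IsLeftPBW le)
    (hM : IsAdmissibleExtension le leM) (he : ∀ i, A.vecExp leM (g i) = e i)
    (h1 : ∀ i, A.vecCoeff (g i) (e i) = 1) (i j : Fin t) :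
    A.vecCoeff (A.r leM g i j • g i) ((e i).1 ⊔ (e j).1, (e i).2) = 1 := by
  have h := A.coeff_stdMonomial_mul hle hA (A.exp_apply_level hle hM (he i)) (h1 i)
    ((e i).1 ⊔ (e j).1 - (e i).1)
  rw [tsub_add_cancel_of_le le_sup_left] at h
  rw [A.r_eq he, vecCoeff_ι_mul_smul]
  simp only [vecCoeff, Pi.smul_apply, smul_eq_mul, h]
  exact inv_mul_cancel₀ (A.q_ne_zero hle.toIsTotalOrder hA _ _)

/-- The leading terms of `r_{ij} g_i` and `r_{ji} g_j` cancel in `SP(g_i, g_j)`. -/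
theorem lt_of_vecCoeff_SP_ne_zero (hle : IsAdmissible le) (hA : A.IsLeftPBW le)
    (hM : IsAdmissibleExtension le leM) (he : ∀ i, A.vecExp leM (g i) = e i)
    (h1 : ∀ i, A.vecCoeff (g i) (e i) = 1) {i j : Fin t} (hij : (e i).2 = (e j).2)
    {v : Idx n m} (hv : A.vecCoeff (A.SP leM g i j) v ≠ 0) :
    leM v ((e i).1 ⊔ (e j).1, (e i).2) ∧ v ≠ ((e i).1 ⊔ (e j).1, (e i).2) := by
  have hi := ((A.vecExp_eq_coe_iff hM.toIsTotalOrder _ _).1 (A.vecExp_r_smul hle hA hM he i j)).2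
  have hj := ((A.vecExp_eq_coe_iff hM.toIsTotalOrder _ _).1 (A.vecExp_r_smul hle hA hM he j i)).2
  have hi1 := A.vecCoeff_r_smul hle hA hM he h1 i j
  have hj1 := A.vecCoeff_r_smul hle hA hM he h1 j i
  rw [sup_comm, ← hij] at hj hj1
  rw [SP, vecCoeff_sub] at hv
  constructor
  · by_cases h : A.vecCoeff (A.r leM g i j • g i) v = 0
    · rw [h, zero_sub, neg_ne_zero] at hv
      exact hj v hv
    · exact hi v h
  · rintro rfl
    rw [hi1, hj1, sub_self] at hv
    exact hv rfl

theorem schreyerSyz_apply (h : A.Pairs leM g → Fin t → R) (p : A.Pairs leM g) :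
    A.schreyerSyz leM g h p = Pi.single p.1.1 (A.r leM g p.1.1 p.1.2)
      - Pi.single p.1.2 (A.r leM g p.1.2 p.1.1) - h p := by
  change Pi.single p.1.1 (A.r leM g p.1.1 p.1.2)
    - Pi.single p.1.2 (A.r leM g p.1.2 p.1.1) - ∑ k, Pi.single k (h p k) = _
  rw [Finset.univ_sum_single]

theorem schreyerSyz_mem {h : A.Pairs leM g → Fin t → R}
    (hh : A.IsSchreyerQuotient leM g le h) (p : A.Pairs leM g) :
    A.schreyerSyz leM g h p ∈ Syz g := by
  rw [Syz, LinearMap.mem_ker, schreyerSyz_apply, map_sub, map_sub,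
    Fintype.linearCombination_apply_single, Fintype.linearCombination_apply_single,
    Fintype.linearCombination_apply, ← (hh p).1, SP, sub_self]

/-- With respect to the induced order, the leading term of `s_{ij}` is that of `r_{ij} e'_i`: the
term `r_{ji} e'_j` is tied with it and loses as `i < j`, and the quotients `h_{ijk}` contribute
only terms below the cancelled leading term of `SP(g_i, g_j)`. -/
theorem vecExp_schreyerSyz (hle : IsAdmissible le) (hA : A.IsLeftPBW le)
    (hM : IsAdmissibleExtension le leM) (he : ∀ i, A.vecExp leM (g i) = e i)
    (h1 : ∀ i, A.vecCoeff (g i) (e i) = 1) {h : A.Pairs leM g → Fin t → R}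
    (hh : A.IsSchreyerQuotient leM g le h) (p : A.Pairs leM g) :
    A.vecExp (A.schreyerLE leM g) (A.schreyerSyz leM g h p) =
      (((e p.1.1).1 ⊔ (e p.1.2).1 - (e p.1.1).1, p.1.1) : Idx n t) := by
  obtain ⟨⟨i, j⟩, hlt, hlev⟩ := p
  set p : A.Pairs leM g := ⟨(i, j), hlt, hlev⟩
  replace hlt : i < j := hlt
  replace hlev : (e i).2 = (e j).2 := by
    simpa only [A.level_eq (he _), WithBot.coe_inj] using hlev
  change _ = ((((e i).1 ⊔ (e j).1 - (e i).1, i) : Idx n t) : WithBot (Idx n t))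
  have hri := A.coeff_r_ne_zero_iff hle.toIsTotalOrder hA he i j
  have hrj := A.coeff_r_ne_zero_iff hle.toIsTotalOrder hA he j i
  have hδi : shift (e i) ((e i).1 ⊔ (e j).1 - (e i).1) = ((e i).1 ⊔ (e j).1, (e i).2) := by
    rw [shift, add_tsub_cancel_of_le le_sup_left]
  have hδj : shift (e j) ((e j).1 ⊔ (e i).1 - (e j).1) = ((e i).1 ⊔ (e j).1, (e i).2) := by
    rw [shift, add_tsub_cancel_of_le le_sup_left, sup_comm, hlev]
  -- The quotients only reach exponents strictly below `(α_i ∨ α_j, level(g_i))`.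
  have hquot : ∀ k β, A.coeff (h p k) β ≠ 0 →
      leM (shift (e k) β) ((e i).1 ⊔ (e j).1, (e i).2) ∧
        shift (e k) β ≠ ((e i).1 ⊔ (e j).1, (e i).2) := by
    intro k β hβ
    have hk0 : h p k ≠ 0 := by
      rintro h0
      rw [h0, coeff_zero] at hβ
      exact hβ rfl
    obtain ⟨α, hα⟩ := A.exists_exp_eq hle.toIsTotalOrder hk0
    have hmax := (hh p).2
    simp only [he, botShift_coe_eq_coe_iff] at hmax
    have hmem : shift (e k) α ∈ {u | ∃ k, ∃ β : Fin n → ℕ,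
        A.exp le (h p k) = (β : WithBot (Fin n → ℕ)) ∧ shift (e k) β = u} := ⟨k, α, hα, rfl⟩
    have hfin : {u | ∃ k, ∃ β : Fin n → ℕ,
        A.exp le (h p k) = (β : WithBot (Fin n → ℕ)) ∧ shift (e k) β = u}.Finite := by
      refine (Set.finite_range fun k => shift (e k) ((A.exp le (h p k)).unbotD 0)).subset ?_
      rintro _ ⟨k, β, hβ, rfl⟩
      exact ⟨k, by simp [hβ]⟩
    obtain ⟨w, hw⟩ := hM.exists_maxOf_eq hfin ⟨_, hmem⟩
    rw [hw] at hmax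
    have hSP := A.lt_of_vecCoeff_SP_ne_zero hle hA hM he h1 hlev
      ((A.vecExp_eq_coe_iff hM.toIsTotalOrder _ _).1 hmax.symm).1
    have hw2 := ((maxOf_eq_coe_iff hM.antisymm _ _).1 hw).2 _ hmem
    have hβα : leM (shift (e k) β) (shift (e k) α) := by
      have := hM.shift_le_shift _ _ (e k).1 (hM.level_le _ _ (e k).2
        (((A.exp_eq_coe_iff hle.toIsTotalOrder _ _).1 hα).2 β hβ))
      simpa only [shift, add_comm] using this
    have hβw := hM.trans _ _ _ hβα hw2
    refine ⟨hM.trans _ _ _ hβw hSP.1, fun heq => hSP.2 (hM.antisymm _ _ hSP.1 ?_)⟩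
    rwa [heq] at hβw
  have hcoeff : ∀ v : Idx n t, A.vecCoeff (A.schreyerSyz leM g h p) v =
      A.coeff ((Pi.single i (A.r leM g i j) : Fin t → R) v.2) v.1
        - A.coeff ((Pi.single j (A.r leM g j i) : Fin t → R) v.2) v.1
        - A.coeff (h p v.2) v.1 := by
    intro v
    rw [schreyerSyz_apply, vecCoeff_sub, vecCoeff_sub]
    rfl
  have hG := (A.isAdmissibleExtension_schreyerLE hM he).toIsTotalOrder
  refine (A.vecExp_eq_coe_iff hG _ _).2 ⟨?_, ?_⟩
  · have h0 : A.coeff (h p i) ((e i).1 ⊔ (e j).1 - (e i).1) = 0 := by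
      by_contra hne
      exact (hquot i _ hne).2 hδi
    rw [hcoeff]
    simp only [Pi.single_eq_same, Pi.single_eq_of_ne hlt.ne, h0, coeff_zero,
      Finsupp.zero_apply, sub_zero]
    exact (hri _).2 rfl
  · rintro ⟨β, k⟩ hv
    rw [A.schreyerLE_iff he]
    simp only [hδi]
    by_cases hhk : A.coeff (h p k) β = 0
    · right
      rw [hcoeff] at hv
      simp only [hhk, sub_zero] at hv
      by_cases hki : k = i
      · subst hki
        simp only [Pi.single_eq_same, Pi.single_eq_of_ne hlt.ne, coeff_zero,
          Finsupp.zero_apply, sub_zero] at hv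
        rw [(hri β).1 hv]
        exact ⟨hδi, le_rfl⟩
      by_cases hkj : k = j
      · subst hkj
        simp only [Pi.single_eq_same, Pi.single_eq_of_ne hki, coeff_zero,
          Finsupp.zero_apply, zero_sub, neg_ne_zero] at hv
        rw [(hrj β).1 hv]
        exact ⟨hδj, hlt.le⟩
      · simp [hki, hkj, coeff_zero] at hv
    · exact Or.inl (hquot k β hhk)

/-- The exponent of a syzygy is divisible by that of some `s_{ij}`: its leading term
contributes a leading term to `∑ h_k g_k = 0`, which another index `j` has to cancel. -/
theorem exists_pair_of_mem_syz (hle : IsAdmissible le) (hA : A.IsLeftPBW le)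
    (hM : IsAdmissibleExtension le leM) (he : ∀ i, A.vecExp leM (g i) = e i)
    {f : Fin t → R} (hf : f ∈ Syz g) {w : Idx n t}
    (hw : A.vecExp (A.schreyerLE leM g) f = w) :
    ∃ (p : A.Pairs leM g) (β : Fin n → ℕ),
      w = shift ((e p.1.1).1 ⊔ (e p.1.2).1 - (e p.1.1).1, p.1.1) β := by
  obtain ⟨α, i⟩ := w
  have hG := A.isAdmissibleExtension_schreyerLE hM he
  have hi := A.vecExp_smul hle hA hM (A.exp_apply_level hle hG hw) (he i)
  have hi0 := ((A.vecExp_eq_coe_iff hM.toIsTotalOrder _ _).1 hi).1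
  have hsum : ∑ k, A.vecCoeff (f k • g k) (shift (e i) α) = 0 := by
    rw [← vecCoeff_sum, ← Fintype.linearCombination_apply, LinearMap.mem_ker.1 hf,
      vecCoeff_zero]
  obtain ⟨j, hji, hj0⟩ : ∃ j, j ≠ i ∧ A.vecCoeff (f j • g j) (shift (e i) α) ≠ 0 := by
    by_contra! hcon
    rw [Finset.sum_eq_single i (fun j _ hj => hcon j hj) (by simp)] at hsum
    exact hi0 hsum
  obtain ⟨β, hβ⟩ := A.exists_exp_eq_of_vecCoeff_smul_ne_zero hle.toIsTotalOrder hj0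
  have hij := ((A.vecExp_eq_coe_iff hM.toIsTotalOrder _ _).1
    (A.vecExp_smul hle hA hM hβ (he j))).2 _ hj0
  have hmax := ((A.vecExp_eq_coe_iff hG.toIsTotalOrder _ _).1 hw).2 (β, j)
    ((A.exp_eq_coe_iff hle.toIsTotalOrder _ _).1 hβ).1
  rw [A.schreyerLE_iff he] at hmax
  -- Both terms have the same image exponent, and the tie is decided by `i < j`.
  obtain ⟨heq, hle_ij⟩ : shift (e j) β = shift (e i) α ∧ i ≤ j :=
    hmax.resolve_left fun h => h.2 (hM.antisymm _ _ h.1 hij)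
  have hlev : A.level leM (g i) = A.level leM (g j) := by
    rw [A.level_eq (he i), A.level_eq (he j)]
    exact congrArg _ (congrArg Prod.snd heq).symm
  have hdiv : (e i).1 ⊔ (e j).1 ≤ (e i).1 + α := by
    refine sup_le le_self_add ?_
    rw [show (e i).1 + α = (e j).1 + β from (congrArg Prod.fst heq).symm]
    exact le_self_add
  refine ⟨⟨(i, j), lt_of_le_of_ne hle_ij hji.symm, hlev⟩,
    α - ((e i).1 ⊔ (e j).1 - (e i).1), Prod.ext ?_ rfl⟩
  exact (add_tsub_cancel_of_le (tsub_le_iff_left.2 hdiv)).symm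

theorem isGroebnerBasis_schreyerSyz (hle : IsAdmissible le) (hA : A.IsLeftPBW le)
    (hM : IsAdmissibleExtension le leM) (hg : ∀ i, A.IsMonic leM (g i))
    {h : A.Pairs leM g → Fin t → R} (hh : A.IsSchreyerQuotient leM g le h) :
    A.IsGroebnerBasis (A.schreyerLE leM g) (Set.range (A.schreyerSyz leM g h)) (Syz g) := by
  choose e he h1 using hg
  have hexp := A.vecExp_schreyerSyz hle hA hM he h1 hh
  refine ⟨Set.finite_range _, ?_, ?_, ?_⟩
  · rintro _ ⟨p, rfl⟩
    exact A.schreyerSyz_mem hh p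
  · rintro _ ⟨p, rfl⟩
    exact A.ne_zero_of_vecExp_eq (hexp p)
  · ext w
    constructor
    · rintro ⟨f, hf, -, hw⟩
      obtain ⟨p, β, rfl⟩ := A.exists_pair_of_mem_syz hle hA hM he hf hw
      exact ⟨_, ⟨p, rfl⟩, _, β, hexp p, rfl⟩
    · rintro ⟨_, ⟨p, rfl⟩, u, β, hu, rfl⟩
      exact A.shift_mem_Exp hle hA (A.isAdmissibleExtension_schreyerLE hM he)
        (A.schreyerSyz_mem hh p) hu β

theorem exists_isSchreyerQuotient (hle : IsAdmissible le) (hA : A.IsLeftPBW le)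
    (hM : IsAdmissibleExtension le leM) (hg : ∀ i, A.IsMonic leM (g i))
    (hG : A.IsGroebnerBasis leM (Set.range g) (Submodule.span R (Set.range g))) :
    ∃ h : A.Pairs leM g → Fin t → R, A.IsSchreyerQuotient leM g le h := by
  choose e he _ using hg
  have hSP : ∀ p : A.Pairs leM g,
      A.SP leM g p.1.1 p.1.2 ∈ Submodule.span R (Set.range g) := fun p =>
    Submodule.sub_mem _ (Submodule.smul_mem _ _ (Submodule.subset_span ⟨_, rfl⟩))
      (Submodule.smul_mem _ _ (Submodule.subset_span ⟨_, rfl⟩))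
  choose h hh using fun p => hG.exists_quotient A hle hA hM he (hSP p)
  exact ⟨h, hh⟩

end LeftPolynomialRing

/-! ### Syzygies of a change of generators -/

section Matrix

open Matrix

variable {R : Type*} [Ring R] {s t m : ℕ} {κ : Type*}

theorem mem_Syz_iff_vecMul (F : Matrix (Fin s) (Fin m) R) (h : Fin s → R) :
    h ∈ Syz F ↔ h ᵥ* F = 0 := by
  refine LinearMap.mem_ker.trans ?_
  rw [vecMul_eq_sum]
  rfl

theorem mem_Syz_row_iff (F : Matrix (Fin s) (Fin m) R) (M : Matrix κ (Fin s) R) :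
    (∀ i, M i ∈ Syz F) ↔ M * F = 0 := by
  simp only [mem_Syz_iff_vecMul]
  exact ⟨fun h => funext h, fun h i => congrFun h i⟩

theorem exists_matrix_mul_eq {F : Matrix (Fin s) (Fin m) R} {G : Matrix κ (Fin m) R}
    (h : ∀ i, G i ∈ Submodule.span R (Set.range F)) :
    ∃ P : Matrix κ (Fin s) R, G = P * F := by
  choose P hP using fun i => (Submodule.mem_span_range_iff_exists_fun R).1 (h i)
  refine ⟨P, funext fun i => ?_⟩
  rw [← hP i, ← vecMul_eq_sum]
  rfl

/-- Syzygies of `F` from generators of the syzygies of `G = P F`, where `F = Q G`: a syzygy `h`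
of `F` is `(h Q) P + h (1 - Q P)`, and `h Q` is a syzygy of `G`. -/
theorem span_fromRows_eq_Syz [Finite κ] {F : Matrix (Fin s) (Fin m) R}
    {G : Matrix (Fin t) (Fin m) R}
    {P : Matrix (Fin t) (Fin s) R} {Q : Matrix (Fin s) (Fin t) R} (hG : G = P * F)
    (hF : F = Q * G) {S : Matrix κ (Fin t) R}
    (hS : Submodule.span R (Set.range S) = Syz G) :
    Submodule.span R (Set.range (fromRows (S * P) (1 - Q * P))) = Syz F := by
  have hSG : S * G = 0 :=
    (mem_Syz_row_iff G S).1 fun i => hS ▸ Submodule.subset_span ⟨i, rfl⟩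
  apply le_antisymm
  · rw [Submodule.span_le]
    rintro _ ⟨i, rfl⟩
    refine (mem_Syz_row_iff F _).2 ?_ i
    rw [fromRows_mul, Matrix.mul_assoc, ← hG, hSG, Matrix.sub_mul, Matrix.mul_assoc, ← hG, ← hF,
      Matrix.one_mul, sub_self, fromRows_zero]
  · intro h hh
    have := Fintype.ofFinite κ
    have hQ : h ᵥ* Q ∈ Submodule.span R (Set.range S) := by
      rw [hS, mem_Syz_iff_vecMul, vecMul_vecMul, ← hF]
      exact (mem_Syz_iff_vecMul F h).1 hh
    obtain ⟨c, hc⟩ := (Submodule.mem_span_range_iff_exists_fun R).1 hQ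
    rw [← vecMul_eq_sum] at hc
    refine (Submodule.mem_span_range_iff_exists_fun R).2 ⟨Sum.elim c h, ?_⟩
    rw [← vecMul_eq_sum, sumElim_vecMul_fromRows, ← vecMul_vecMul, hc, vecMul_vecMul,
      ← vecMul_add, add_sub_cancel, vecMul_one]

end Matrix

end PBW

theorem mainTheorem8 {D R : Type*} [DivisionRing D] [Ring R] {n : ℕ}
    (A : PBW.LeftPolynomialRing D R n)
    (le : (Fin n → ℕ) → (Fin n → ℕ) → Prop) (hle : PBW.IsAdmissible le)
    (hA : A.IsLeftPBW le) {m : ℕ}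
    (leM : PBW.Idx n m → PBW.Idx n m → Prop) (hM : PBW.IsAdmissibleExtension le leM) :
    -- the Schreyer syzygies exist and form a Gröbner basis with respect to the induced order
    (∀ (t : ℕ) (g : Fin t → Fin m → R), (∀ i, A.IsMonic leM (g i)) →
      A.IsGroebnerBasis leM (Set.range g) (Submodule.span R (Set.range g)) →
      PBW.IsAdmissibleExtension le (A.schreyerLE leM g) ∧
      (∃ h : A.Pairs leM g → Fin t → R, A.IsSchreyerQuotient leM g le h) ∧
      ∀ h : A.Pairs leM g → Fin t → R, A.IsSchreyerQuotient leM g le h →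
        A.IsGroebnerBasis (A.schreyerLE leM g) (Set.range (A.schreyerSyz leM g h))
          (PBW.Syz g)) ∧
    -- every finite `F` admits a monic Gröbner basis `G` with `G = P F` and `F = Q G`
    (∀ (s : ℕ) (F : Matrix (Fin s) (Fin m) R),
      ∃ (t : ℕ) (G : Matrix (Fin t) (Fin m) R) (P : Matrix (Fin t) (Fin s) R)
        (Q : Matrix (Fin s) (Fin t) R),
        (∀ i, A.IsMonic leM (G i)) ∧
        A.IsGroebnerBasis leM (Set.range G) (Submodule.span R (Set.range F)) ∧
        G = P * F ∧ F = Q * G) ∧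
    -- for all such data the rows of the block matrix `(syz(G) P ; 1 - Q P)` generate `Syz(F)`
    (∀ (s : ℕ) (F : Matrix (Fin s) (Fin m) R) (t : ℕ) (G : Matrix (Fin t) (Fin m) R)
      (P : Matrix (Fin t) (Fin s) R) (Q : Matrix (Fin s) (Fin t) R),
      (∀ i, A.IsMonic leM (G i)) →
      A.IsGroebnerBasis leM (Set.range G) (Submodule.span R (Set.range F)) →
      G = P * F → F = Q * G →
      ∀ h : A.Pairs leM G → Fin t → R, A.IsSchreyerQuotient leM G le h →
        Submodule.span R
          (Set.range (Matrix.fromRows (A.schreyerSyz leM G h * P) (1 - Q * P))) =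
          PBW.Syz F) := by
  refine ⟨fun t g hg hG => ?_, fun s F => ?_, fun s F t G P Q hmonic hG hGF hFG h hh => ?_⟩
  · choose e he _ using id hg
    exact ⟨A.isAdmissibleExtension_schreyerLE hM he,
      A.exists_isSchreyerQuotient hle hA hM hg hG,
      fun h hh => A.isGroebnerBasis_schreyerSyz hle hA hM hg hh⟩
  · obtain ⟨t, G, hmonic, hG⟩ :=
      A.exists_isGroebnerBasis hle hA hM (Submodule.span R (Set.range F))
    obtain ⟨P, hP⟩ := PBW.exists_matrix_mul_eq fun i => hG.subset _ ⟨i, rfl⟩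
    have hspan := hG.span_eq A hle hA hM
    obtain ⟨Q, hQ⟩ := PBW.exists_matrix_mul_eq (F := G) (G := F) fun i =>
      hspan ▸ Submodule.subset_span ⟨i, rfl⟩
    exact ⟨t, G, P, Q, hmonic, hG, hP, hQ⟩
  · choose e he _ using id hmonic
    exact PBW.span_fromRows_eq_Syz hGF hFG
      ((A.isGroebnerBasis_schreyerSyz hle hA hM hmonic hh).span_eq A hle hA
        (A.isAdmissibleExtension_schreyerLE hM he))
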